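/- Let $m,n,N\in\mathbb N$ and let $\mathcal A v=\sum_{j=1}^m A_j\,\partial_j v$, with constant matrices $A_1,\dots,A_m\in\mathbb R^{N\times n}$, be a homogeneous linear differential operator of order one acting on $\mathbb R^n$-valued maps of $m$ variables. Let $$\Lambda_{\mathcal A}=\Bigl\{\eta\in\mathbb R^n:\ \exists\,\xi\in\mathbb R^m\setminus\{0\}\ \text{ with }\ \sum_{j=1}^m\xi_jA_j\eta=0\Bigr\}$$ be its wave cone. Let $\Omega\subset\mathbb R^m$ be open and connected, let $a_1,a_2,a_3\in\mathbb R^n$ satisfy $a_i-a_j\notin\Lambda_{\mathcal A}$ for all $i\ne j$, and let $u\in L^\infty(\Omega;\mathbb R^n)$ satisfy $$u(x)\in\{a_1,a_2,a_3\}\ \text{ for a.e. }x\in\Omega,\qquad \mathcal A u=0\ \text{ in }\Omega\text{ in the sense of distributions}.$$ Then $u$ is constant, i.e. there is $c\in\mathbb R^n$ with $u(x)=c$ for a.e. $x\in\Omega$. -/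

import Mathlib

open MeasureTheory
open scoped ContDiff Matrix

/-- The homogeneous linear differential operators of order one with constant coefficients,
`𝒜 v = ∑ j, A j (∂ v / ∂ x j)`, acting on maps `v` from a subset of `ℝ^m` to `ℝ^n`, with values
in `ℝ^N`. Such an operator is given by its coefficient matrices `A j ∈ ℝ^{N × n}`. -/
structure FirstOrderOp (m n N : ℕ) where
  /-- the coefficient matrix of the partial derivative in the direction `j` -/
  coeff : Fin m → Matrix (Fin N) (Fin n) ℝ

namespace FirstOrderOp

variable {m n N : ℕ}

/-- The principal symbol `𝔸(ξ) = ∑ j, ξ j • A j`. -/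
def symbol (A : FirstOrderOp m n N) (ξ : EuclideanSpace ℝ (Fin m)) :
    Matrix (Fin N) (Fin n) ℝ :=
  ∑ j, ξ j • A.coeff j

/-- The wave cone: the union over all `ξ ≠ 0` of the kernels of the matrices `𝔸(ξ)`. -/
def waveCone (A : FirstOrderOp m n N) : Set (EuclideanSpace ℝ (Fin n)) :=
  {η | ∃ ξ : EuclideanSpace ℝ (Fin m), ξ ≠ 0 ∧ A.symbol ξ *ᵥ η.ofLp = 0}

/-- `𝒜 u = 0` in `Ω` in the sense of distributions: each of the `N` components of `𝒜 u`
vanishes when it is paired with an arbitrary real test function in `C_c^∞(Ω)`. -/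
def DistribEqZero (A : FirstOrderOp m n N) (Ω : Set (EuclideanSpace ℝ (Fin m)))
    (u : EuclideanSpace ℝ (Fin m) → EuclideanSpace ℝ (Fin n)) : Prop :=
  ∀ φ : EuclideanSpace ℝ (Fin m) → ℝ,
    ContDiff ℝ ∞ φ → HasCompactSupport φ → tsupport φ ⊆ Ω →
      ∀ i : Fin N,
        -∫ x in Ω, ∑ j, (A.coeff j *ᵥ (u x).ofLp) i *
          fderiv ℝ φ x (EuclideanSpace.single j 1) = 0

/-- `u ∈ L^∞(Ω; ℝ^n)` is a solution of the `s`-state problem for `𝒜` with the states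
`a 0, …, a (s - 1)`. -/
structure IsStateSolution (A : FirstOrderOp m n N) (Ω : Set (EuclideanSpace ℝ (Fin m)))
    {s : ℕ} (a : Fin s → EuclideanSpace ℝ (Fin n))
    (u : EuclideanSpace ℝ (Fin m) → EuclideanSpace ℝ (Fin n)) : Prop where
  memLp : MemLp u ⊤ (volume.restrict Ω)
  mem_states : ∀ᵐ x ∂(volume.restrict Ω), u x ∈ Set.range a
  distribEqZero : A.DistribEqZero Ω u
  sub_notMem : ∀ i j, i ≠ j → a i - a j ∉ A.waveCone

end FirstOrderOp

/-!
Almost everywhere `u = a₂ + χ₁ (a₀ - a₂) + χ₂ (a₁ - a₂)`, where `χ₁`, `χ₂` are the indicators of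
two disjoint sets. Writing `L η` for the linear map `ξ ↦ 𝔸(ξ) η`, the equation `𝒜 u = 0` becomes
`L α ∇χ₁ + L β ∇χ₂ = 0` with `α = a₀ - a₂` and `β = a₁ - a₂`, and the hypothesis on the states says
that `L α`, `L β` and `L α - L β = L (a₀ - a₁)` are injective.

Let `T ⊆ ℂ^m` be the space of those complex directions `z` in which both weak derivatives
`z · ∇χ₁` and `z · ∇χ₂` vanish. The transposes of the three injective maps are surjective onto
`ℂ^m`, so if `T ≠ ℂ^m`, an eigenvector argument in `ℂ^m / T` (`exists_pencil_eigenvector`) gives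
`z ∉ T` and `μ ∉ {0, 1}` with `z · ∇f = 0` for `f = χ₁ + μ χ₂`. A first order homogeneous equation
is inherited by the square of a bounded solution
(`IsBddMeas.dotProduct_weakGrad_sq_eq_zero`, by mollification and the Leibniz rule), and
`f² = χ₁ + μ² χ₂`. As `μ² ≠ μ`, the two equations force `z · ∇χ₁ = z · ∇χ₂ = 0`, that is `z ∈ T`,
a contradiction. No ellipticity or regularity theory is involved.

Hence `T = ℂ^m` (`weakGrad_eq_zero_of_symbol_relation`), so `χ₁` and `χ₂` have vanishing weak
gradient and are constant on the connected set `Ω` (`IsBddMeas.ae_eq_const`).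
-/

/-! ### Linear algebra -/

/-- Two surjections `P`, `Q` onto a nonzero space, whose difference is surjective too, have a common
"eigenvector" with eigenvalue different from `0` and `1`, which is not in the kernel of `P`. -/
lemma exists_pencil_eigenvector {K V W : Type*} [Field K] [IsAlgClosed K]
    [AddCommGroup V] [Module K V] [FiniteDimensional K V] [Nontrivial V]
    [AddCommGroup W] [Module K W] (P Q : W →ₗ[K] V)
    (hP : Function.Surjective P) (hQ : Function.Surjective Q)
    (hPQ : Function.Surjective (P - Q)) :
    ∃ (μ : K) (y : W), μ ≠ 0 ∧ μ ≠ 1 ∧ Q y = μ • P y ∧ P y ≠ 0 := by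
  obtain ⟨R, hR⟩ := P.exists_rightInverse_of_surjective (LinearMap.range_eq_top.2 hP)
  have hR' : ∀ v, P (R v) = v := fun v => LinearMap.congr_fun hR v
  by_cases hker : ∀ y, P y = 0 → Q y = 0
  · -- `Q` descends along `P` to the endomorphism `Q ∘ R`, any eigenvector of which will do.
    have hfac : ∀ y, Q y = (Q ∘ₗ R) (P y) := fun y => by
      have := hker (y - R (P y)) (by simp [hR'])
      simpa [sub_eq_zero] using this
    obtain ⟨μ, hμ⟩ := Module.End.exists_eigenvalue (Q ∘ₗ R)
    obtain ⟨z, hz⟩ := hμ.exists_hasEigenvector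
    have hz1 : Q (R z) = μ • z := hz.apply_eq_smul
    have hinj : Function.Injective (Q ∘ₗ R) := by
      rw [LinearMap.injective_iff_surjective]
      intro v
      obtain ⟨y, rfl⟩ := hQ v
      exact ⟨P y, (hfac y).symm⟩
    have hinj' : Function.Injective (LinearMap.id - Q ∘ₗ R : V →ₗ[K] V) := by
      rw [LinearMap.injective_iff_surjective]
      intro v
      obtain ⟨y, rfl⟩ := hPQ v
      exact ⟨P y, by simp [hfac y]⟩
    refine ⟨μ, R z, ?_, ?_, by rw [hR', hz1], by rw [hR']; exact hz.2⟩
    · rintro rfl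
      exact hz.2 (hinj (by simp [hz1]))
    · rintro rfl
      exact hz.2 (hinj' (by simp [hz1]))
  · -- Perturbing `R` by `ker P` moves the eigenvalue to any `μ` outside the spectrum of `Q ∘ R`.
    push Not at hker
    obtain ⟨k, hk, hQk⟩ := hker
    have hfin : ((spectrum K (Q ∘ₗ R : Module.End K V)) ∪ {0, 1}).Finite :=
      (Module.End.finite_spectrum _).union (Set.toFinite _)
    obtain ⟨μ, hμ⟩ := hfin.infinite_compl.nonempty
    simp only [Set.mem_compl_iff, Set.mem_union, Set.mem_insert_iff, Set.mem_singleton_iff,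
      not_or] at hμ
    obtain ⟨hs, h0, h1⟩ := hμ
    rw [spectrum.notMem_iff, Module.End.isUnit_iff] at hs
    obtain ⟨z, hz⟩ := hs.2 (Q k)
    have hz' : μ • z - Q (R z) = Q k := by
      simpa [Module.algebraMap_end_apply] using hz
    refine ⟨μ, R z + k, h0, h1, ?_, ?_⟩
    · simp [hR', hk, ← hz']
    · simp only [map_add, hR', hk, add_zero]
      rintro rfl
      exact hQk (by simpa using hz'.symm)

/-- The transpose of an injective real matrix is surjective, also over `ℂ`. -/
lemma surjective_mulVecLin_transpose_map_ofReal {m N : ℕ} (B : Matrix (Fin N) (Fin m) ℝ)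
    (hB : ∀ ξ, B *ᵥ ξ = 0 → ξ = 0) :
    Function.Surjective (Bᵀ.map ((↑) : ℝ → ℂ)).mulVecLin := by
  obtain ⟨g, hg⟩ := B.mulVecLin.exists_leftInverse_of_injective
    (LinearMap.ker_eq_bot'.2 (by simpa using hB))
  have hC : LinearMap.toMatrix' g * B = 1 := by
    apply_fun LinearMap.toMatrix' at hg
    rw [LinearMap.toMatrix'_comp, LinearMap.toMatrix'_id] at hg
    rwa [← Matrix.toLin'_apply', LinearMap.toMatrix'_toLin'] at hg
  have h : Bᵀ.map ((↑) : ℝ → ℂ) * (LinearMap.toMatrix' g)ᵀ.map ((↑) : ℝ → ℂ) = 1 := by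
    have : (Bᵀ * (LinearMap.toMatrix' g)ᵀ).map ((↑) : ℝ → ℂ) = 1 := by
      rw [← Matrix.transpose_mul, hC, Matrix.transpose_one]
      exact Matrix.map_one _ Complex.ofReal_zero Complex.ofReal_one
    rw [← this]
    exact (Matrix.map_mul (f := Complex.ofRealHom)).symm
  intro v
  refine ⟨((LinearMap.toMatrix' g)ᵀ.map ((↑) : ℝ → ℂ)) *ᵥ v, ?_⟩
  rw [Matrix.mulVecLin_apply, Matrix.mulVec_mulVec, h, Matrix.one_mulVec]

/-! ### Weak gradients -/

section WeakGradient

variable {m : ℕ} {Ω : Set (EuclideanSpace ℝ (Fin m))}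

/-- The complex-valued test functions in `C_c^∞(Ω)`. -/
structure IsTestFunction (Ω : Set (EuclideanSpace ℝ (Fin m)))
    (φ : EuclideanSpace ℝ (Fin m) → ℂ) : Prop where
  contDiff : ContDiff ℝ ∞ φ
  hasCompactSupport : HasCompactSupport φ
  tsupport_subset : tsupport φ ⊆ Ω

/-- The vector of partial derivatives of `φ` at `x`. -/
noncomputable def partials (φ : EuclideanSpace ℝ (Fin m) → ℂ) (x : EuclideanSpace ℝ (Fin m)) :
    Fin m → ℂ :=
  fun j => fderiv ℝ φ x (EuclideanSpace.single j 1)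

/-- The weak gradient of `f` on `Ω` paired with `φ`, without the customary minus sign: the vector of
the integrals `∫ f ∂ⱼφ`. The derivative of `f` in a complex direction `z ∈ ℂ^m` vanishes weakly when
`z ⬝ᵥ weakGrad Ω f φ = 0` for all test functions `φ`. -/
noncomputable def weakGrad (Ω : Set (EuclideanSpace ℝ (Fin m)))
    (f φ : EuclideanSpace ℝ (Fin m) → ℂ) : Fin m → ℂ :=
  fun j => ∫ x in Ω, f x * partials φ x j

/-- `f` is bounded, and measurable on `Ω` up to a null set. The bound is imposed at every point of
the whole space, rather than almost everywhere on `Ω`. -/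
structure IsBddMeas (Ω : Set (EuclideanSpace ℝ (Fin m)))
    (f : EuclideanSpace ℝ (Fin m) → ℂ) : Prop where
  aestronglyMeasurable : AEStronglyMeasurable f (volume.restrict Ω)
  bounded : ∃ C, ∀ x, ‖f x‖ ≤ C

variable {f g φ : EuclideanSpace ℝ (Fin m) → ℂ}

lemma IsBddMeas.integrable_mul (hf : IsBddMeas Ω f) (hg : Integrable g (volume.restrict Ω)) :
    Integrable (fun x => f x * g x) (volume.restrict Ω) := by
  obtain ⟨C, hC⟩ := hf.bounded
  exact hg.bdd_mul hf.aestronglyMeasurable (Filter.Eventually.of_forall hC)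

lemma IsBddMeas.add (hf : IsBddMeas Ω f) (hg : IsBddMeas Ω g) :
    IsBddMeas Ω (fun x => f x + g x) := by
  obtain ⟨C, hC⟩ := hf.bounded
  obtain ⟨D, hD⟩ := hg.bounded
  exact ⟨hf.aestronglyMeasurable.add hg.aestronglyMeasurable,
    C + D, fun x => (norm_add_le _ _).trans (add_le_add (hC x) (hD x))⟩

lemma IsBddMeas.const_mul (hf : IsBddMeas Ω f) (c : ℂ) : IsBddMeas Ω (fun x => c * f x) := by
  obtain ⟨C, hC⟩ := hf.bounded
  refine ⟨hf.aestronglyMeasurable.const_mul c, ‖c‖ * C, fun x => ?_⟩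
  rw [norm_mul]
  exact mul_le_mul_of_nonneg_left (hC x) (norm_nonneg c)

namespace IsTestFunction

lemma continuous_partials (hφ : IsTestFunction Ω φ) (j : Fin m) :
    Continuous (fun x => partials φ x j) :=
  (hφ.contDiff.continuous_fderiv (by simp)).clm_apply continuous_const

lemma integrable_partials (hφ : IsTestFunction Ω φ) (j : Fin m) :
    Integrable (fun x => partials φ x j) :=
  (hφ.continuous_partials j).integrable_of_hasCompactSupport
    (hφ.hasCompactSupport.fderiv_apply ℝ _)

lemma continuous_dotProduct_partials (hφ : IsTestFunction Ω φ) (z : Fin m → ℂ) :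
    Continuous (fun x => z ⬝ᵥ partials φ x) :=
  continuous_finsetSum _ fun j _ => continuous_const.mul (hφ.continuous_partials j)

lemma integrable_dotProduct_partials (hφ : IsTestFunction Ω φ) (z : Fin m → ℂ) :
    Integrable (fun x => z ⬝ᵥ partials φ x) :=
  integrable_finsetSum _ fun j _ => (hφ.integrable_partials j).const_mul (z j)

lemma mul_left (hφ : IsTestFunction Ω φ) {ψ : EuclideanSpace ℝ (Fin m) → ℂ}
    (hψ : ContDiff ℝ ∞ ψ) : IsTestFunction Ω (fun x => ψ x * φ x) :=
  ⟨hψ.mul hφ.contDiff, hφ.hasCompactSupport.mul_left,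
    (tsupport_mul_subset_right).trans hφ.tsupport_subset⟩

end IsTestFunction

lemma partials_mul {ψ : EuclideanSpace ℝ (Fin m) → ℂ} {x : EuclideanSpace ℝ (Fin m)}
    (hψ : DifferentiableAt ℝ ψ x) (hφ : DifferentiableAt ℝ φ x) :
    partials (fun x => ψ x * φ x) x = ψ x • partials φ x + φ x • partials ψ x := by
  funext j
  simp [partials, fderiv_fun_mul hψ hφ]

lemma dotProduct_weakGrad (hf : IsBddMeas Ω f) (hφ : IsTestFunction Ω φ) (z : Fin m → ℂ) :
    z ⬝ᵥ weakGrad Ω f φ = ∫ x in Ω, f x * (z ⬝ᵥ partials φ x) := by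
  simp only [dotProduct, weakGrad, Finset.mul_sum]
  rw [integral_finsetSum]
  · refine Finset.sum_congr rfl fun j _ => ?_
    rw [← integral_const_mul]
    congr with x
    ring
  · intro j _
    exact hf.integrable_mul ((hφ.integrable_partials j).integrableOn.const_mul (z j))

lemma weakGrad_add_const_mul (hf : IsBddMeas Ω f) (hg : IsBddMeas Ω g)
    (hφ : IsTestFunction Ω φ) (c : ℂ) :
    weakGrad Ω (fun x => f x + c * g x) φ = weakGrad Ω f φ + c • weakGrad Ω g φ := by
  funext j
  simp only [weakGrad, Pi.add_apply, Pi.smul_apply, smul_eq_mul, add_mul, mul_assoc]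
  rw [integral_add, integral_const_mul]
  · exact hf.integrable_mul (hφ.integrable_partials j).integrableOn
  · exact (hg.integrable_mul (hφ.integrable_partials j).integrableOn).const_mul c

open Filter Topology Convolution in
/-- Bounded functions have uniformly bounded smooth approximations `F k`, which converge almost
everywhere. At points at distance more than `δ` from the complement of `Ω`, the gradient of `F k` is
minus the weak gradient paired with a translated and reflected mollifier, so `F k` inherits there
any linear relation satisfied by the weak gradient. -/
lemma IsBddMeas.exists_mollification (hΩ : MeasurableSet Ω) (hf : IsBddMeas Ω f) {δ : ℝ}
    (hδ : 0 < δ) :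
    ∃ F : ℕ → EuclideanSpace ℝ (Fin m) → ℂ, (∀ k, ContDiff ℝ ∞ (F k)) ∧
      (∃ C, ∀ k x, ‖F k x‖ ≤ C) ∧
      (∀ᵐ x ∂(volume.restrict Ω), Tendsto (fun k => F k x) atTop (𝓝 (f x))) ∧
      ∀ k x, Metric.closedBall x δ ⊆ Ω →
        ∃ φ, IsTestFunction Ω φ ∧ partials (F k) x = -weakGrad Ω f φ := by
  obtain ⟨C, hC⟩ := hf.bounded
  set g : EuclideanSpace ℝ (Fin m) → ℂ := Ω.indicator f with hg
  have hgm : AEStronglyMeasurable g volume :=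
    (aestronglyMeasurable_indicator_iff hΩ).2 hf.aestronglyMeasurable
  have hgC : ∀ x, ‖g x‖ ≤ C := fun x => (norm_indicator_le_norm_self f x).trans (hC x)
  have hC0 : 0 ≤ C := (norm_nonneg _).trans (hC 0)
  have hgl : LocallyIntegrable g volume :=
    (memLp_top_of_bound hgm C (Eventually.of_forall hgC)).locallyIntegrable le_top
  let ρ : ℕ → ContDiffBump (0 : EuclideanSpace ℝ (Fin m)) := fun k =>
    ⟨δ / (k + 1) / 2, δ / (k + 1), by positivity, half_lt_self (by positivity)⟩
  have hρδ : ∀ k, (ρ k).rOut ≤ δ := fun k =>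
    div_le_self hδ.le (by linarith [Nat.cast_nonneg (α := ℝ) k])
  have hρ0 : Tendsto (fun k => (ρ k).rOut) atTop (𝓝 0) :=
    by simpa [ρ, div_eq_mul_inv] using
      (tendsto_one_div_add_atTop_nhds_zero_nat (𝕜 := ℝ)).const_mul δ
  have hcs : ∀ k, HasCompactSupport ((ρ k).normed volume) := fun k => (ρ k).hasCompactSupport_normed
  have hcd : ∀ k, ContDiff ℝ ∞ ((ρ k).normed volume) := fun k => (ρ k).contDiff_normed
  refine ⟨fun k => (ρ k).normed volume ⋆[ContinuousLinearMap.lsmul ℝ ℝ, volume] g,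
    fun k => (hcs k).contDiff_convolution_left _ (hcd k) hgl, ⟨C, fun k x => ?_⟩, ?_, ?_⟩
  · rw [← dist_zero_right]
    exact dist_convolution_le hC0 (ρ k).support_normed_eq.subset (ρ k).nonneg_normed
      (ρ k).integral_normed hgm (fun y _ => by simpa using hgC y)
  · have h := ContDiffBump.ae_convolution_tendsto_right_of_locallyIntegrable (K := 2) hρ0
      (Eventually.of_forall fun k => by simp only [ρ]; linarith) hgl
    filter_upwards [ae_restrict_of_ae h, ae_restrict_mem hΩ] with x hx hxΩ
    simpa [hg, hxΩ] using hx
  · intro k x hx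
    let φ : EuclideanSpace ℝ (Fin m) → ℂ := fun t => (((ρ k).normed volume (x - t) : ℝ) : ℂ)
    have hsupp : Function.support φ ⊆ Metric.ball x (ρ k).rOut := by
      intro t ht
      have : x - t ∈ Function.support ((ρ k).normed volume) := by
        simpa [φ] using ht
      rw [(ρ k).support_normed_eq] at this
      simpa [dist_eq_norm, norm_sub_rev] using this
    have htsupp : tsupport φ ⊆ Metric.closedBall x (ρ k).rOut :=
      closure_minimal (hsupp.trans Metric.ball_subset_closedBall) Metric.isClosed_closedBall
    refine ⟨φ, ⟨?_, ?_, ?_⟩, ?_⟩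
    · exact Complex.ofRealCLM.contDiff.comp ((hcd k).comp (contDiff_const.sub contDiff_id))
    · exact (isCompact_closedBall x (ρ k).rOut).of_isClosed_subset (isClosed_tsupport _) htsupp
    · exact htsupp.trans ((Metric.closedBall_subset_closedBall (hρδ k)).trans hx)
    · have hcd1 : ContDiff ℝ 1 ((ρ k).normed volume) := (hcd k).of_le (by simp)
      have hpart : ∀ t j, partials φ t j =
          -((fderiv ℝ ((ρ k).normed volume) (x - t) (EuclideanSpace.single j 1) : ℝ) : ℂ) := by
        intro t j
        have h1 : HasFDerivAt (fun t => (ρ k).normed volume (x - t))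
            ((fderiv ℝ ((ρ k).normed volume) (x - t)).comp
              (-ContinuousLinearMap.id ℝ (EuclideanSpace ℝ (Fin m)))) t :=
          ((hcd1.differentiable one_ne_zero) (x - t)).hasFDerivAt.comp t
            ((hasFDerivAt_id t).const_sub x)
        have h2 := (Complex.ofRealCLM.hasFDerivAt.comp t h1).fderiv
        have h3 : fderiv ℝ φ t = _ := h2
        simp [partials, h3]
      funext j
      have hconv : fderiv ℝ ((ρ k).normed volume ⋆[ContinuousLinearMap.lsmul ℝ ℝ, volume] g) x =
          (g ⋆[((ContinuousLinearMap.lsmul ℝ ℝ).flip).precompR (EuclideanSpace ℝ (Fin m)), volume]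
            fderiv ℝ ((ρ k).normed volume)) x := by
        rw [← convolution_flip]
        exact ((hcs k).hasFDerivAt_convolution_right _ hgl hcd1 x).fderiv
      rw [partials, hconv, convolution_precompR_apply _ hgl ((hcs k).fderiv ℝ)
        (hcd1.continuous_fderiv one_ne_zero), convolution_def]
      simp only [Pi.neg_apply, weakGrad, hpart]
      rw [← integral_neg, ← integral_indicator hΩ]
      congr with t
      by_cases ht : t ∈ Ω <;> simp [hg, ht, mul_comm]

end WeakGradient

/-! ### Squares of solutions and functions with vanishing weak gradient -/

section Consequences

open Filter Topology

variable {m : ℕ} {Ω : Set (EuclideanSpace ℝ (Fin m))} {f : EuclideanSpace ℝ (Fin m) → ℂ}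

/-- If the derivative of a bounded `f` in the complex direction `z` vanishes weakly, then so does
that of `f ^ 2`. For smooth `ψ` with `z · ∇ψ = 0` near the support of `φ`, testing the equation with
`ψ φ` gives `∫ f ψ (z · ∇φ) = 0`; take for `ψ` the mollifications of `f`. -/
lemma IsBddMeas.dotProduct_weakGrad_sq_eq_zero (hΩ : IsOpen Ω) (hf : IsBddMeas Ω f)
    {z : Fin m → ℂ} (h : ∀ φ, IsTestFunction Ω φ → z ⬝ᵥ weakGrad Ω f φ = 0)
    {φ : EuclideanSpace ℝ (Fin m) → ℂ} (hφ : IsTestFunction Ω φ) :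
    z ⬝ᵥ weakGrad Ω (fun x => f x * f x) φ = 0 := by
  obtain ⟨δ, hδ, hδΩ⟩ := hφ.hasCompactSupport.isCompact.exists_cthickening_subset_open hΩ
    hφ.tsupport_subset
  obtain ⟨F, hF, ⟨C, hFC⟩, hFf, hFgrad⟩ := hf.exists_mollification hΩ.measurableSet hδ
  obtain ⟨D, hD⟩ := hf.bounded
  have hD0 : 0 ≤ D := (norm_nonneg _).trans (hD 0)
  have hff : IsBddMeas Ω (fun x => f x * f x) :=
    ⟨hf.aestronglyMeasurable.mul hf.aestronglyMeasurable, D * D, fun x => by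
      rw [norm_mul]; exact mul_le_mul (hD x) (hD x) (norm_nonneg _) hD0⟩
  have hzero : ∀ k, ∫ x in Ω, f x * (F k x * (z ⬝ᵥ partials φ x)) = 0 := by
    intro k
    have h1 := h _ (hφ.mul_left (hF k))
    rw [dotProduct_weakGrad hf (hφ.mul_left (hF k))] at h1
    rw [← h1]
    congr with x
    rw [partials_mul ((hF k).differentiable (by simp) x) (hφ.contDiff.differentiable (by simp) x),
      dotProduct_add, dotProduct_smul, dotProduct_smul]
    by_cases hx : φ x = 0
    · simp [hx]
    · obtain ⟨ψ, hψ, hFψ⟩ := hFgrad k x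
        ((Metric.closedBall_subset_cthickening (subset_tsupport φ hx) δ).trans hδΩ)
      simp [hFψ, h ψ hψ]
  rw [dotProduct_weakGrad hff hφ]
  refine tendsto_nhds_unique (f := fun k : ℕ => ∫ x in Ω, f x * (F k x * (z ⬝ᵥ partials φ x)))
    (l := atTop) ?_ (by simp [hzero])
  refine tendsto_integral_of_dominated_convergence
    (fun x => D * (C * ‖z ⬝ᵥ partials φ x‖)) (fun k => ?_) ?_ (fun k => ?_) ?_
  · exact hf.aestronglyMeasurable.mul
      (((hF k).continuous.mul (hφ.continuous_dotProduct_partials z)).aestronglyMeasurable)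
  · exact (((hφ.integrable_dotProduct_partials z).norm.const_mul C).const_mul D).integrableOn
  · refine Eventually.of_forall fun x => ?_
    rw [norm_mul, norm_mul]
    exact mul_le_mul (hD x) (mul_le_mul_of_nonneg_right (hFC k x) (norm_nonneg _))
      (by positivity) hD0
  · filter_upwards [hFf] with x hx
    simpa [mul_assoc] using (hx.mul_const (z ⬝ᵥ partials φ x)).const_mul (f x)

lemma ae_eq_const_of_locally (hΩ : IsPreconnected Ω)
    (h : ∀ x ∈ Ω, ∃ B, IsOpen B ∧ x ∈ B ∧ ∃ c, ∀ᵐ y ∂(volume.restrict B), f y = c) :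
    ∃ c, ∀ᵐ x ∂(volume.restrict Ω), f x = c := by
  rcases Ω.eq_empty_or_nonempty with rfl | ⟨x₀, hx₀⟩
  · exact ⟨0, by simp⟩
  obtain ⟨B₀, hB₀, hxB₀, c, hc⟩ := h x₀ hx₀
  -- The union of the open sets on which `f` is constant with a value satisfying `p`.
  let U (p : ℂ → Prop) : Set (EuclideanSpace ℝ (Fin m)) :=
    ⋃₀ {B | IsOpen B ∧ ∃ c, p c ∧ ∀ᵐ y ∂(volume.restrict B), f y = c}
  have hU : ∀ p, IsOpen (U p) := fun p => isOpen_sUnion fun B hB => hB.1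
  have hdisj : Disjoint (U (· = c)) (U (· ≠ c)) := by
    rw [Set.disjoint_left]
    rintro x ⟨B, ⟨hB, _, rfl, hBc⟩, hxB⟩ ⟨B', ⟨hB', c', hc', hBc'⟩, hxB'⟩
    have h1 : ∀ᵐ y ∂(volume.restrict (B ∩ B')), False := by
      filter_upwards [ae_restrict_of_ae_restrict_of_subset Set.inter_subset_left hBc,
        ae_restrict_of_ae_restrict_of_subset Set.inter_subset_right hBc'] with y hy hy'
      exact hc' (hy'.symm.trans hy)
    rw [eventually_false_iff_eq_bot, ae_eq_bot, Measure.restrict_eq_zero] at h1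
    exact ((hB.inter hB').measure_pos volume ⟨x, hxB, hxB'⟩).ne' h1
  have hcover : Ω ⊆ U (· = c) ∪ U (· ≠ c) := by
    intro x hx
    obtain ⟨B, hB, hxB, c', hc'⟩ := h x hx
    by_cases hcc : c' = c
    · exact Or.inl ⟨B, ⟨hB, c', hcc, hc'⟩, hxB⟩
    · exact Or.inr ⟨B, ⟨hB, c', hcc, hc'⟩, hxB⟩
  have hsub := hΩ.subset_left_of_subset_union (hU _) (hU _) hdisj hcover
    ⟨x₀, hx₀, B₀, ⟨hB₀, c, rfl, hc⟩, hxB₀⟩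
  refine ⟨c, ae_restrict_of_ae_restrict_of_subset hsub ?_⟩
  rw [ae_restrict_iff' (hU _).measurableSet, ae_iff]
  refine measure_null_of_locally_null _ fun x hx => ?_
  obtain ⟨⟨B, ⟨hB, c', hcc, hBc⟩, hxB⟩, -⟩ := Classical.not_imp.1 hx
  rw [ae_restrict_iff' hB.measurableSet, ae_iff] at hBc
  refine ⟨_, inter_mem_nhdsWithin _ (hB.mem_nhds hxB), measure_mono_null ?_ hBc⟩
  rintro y ⟨hy, hyB⟩ hy'
  exact (Classical.not_imp.1 hy).2 ((hy' hyB).trans hcc)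

lemma IsBddMeas.ae_eq_const (hΩ : IsOpen Ω) (hΩc : IsPreconnected Ω) (hf : IsBddMeas Ω f)
    (h : ∀ φ, IsTestFunction Ω φ → weakGrad Ω f φ = 0) :
    ∃ c, ∀ᵐ x ∂(volume.restrict Ω), f x = c := by
  refine ae_eq_const_of_locally hΩc fun x hx => ?_
  obtain ⟨r, hr, hrΩ⟩ := Metric.isOpen_iff.1 hΩ x hx
  obtain ⟨F, hF, -, hFf, hFgrad⟩ :=
    hf.exists_mollification hΩ.measurableSet (δ := r / 2) (by positivity)
  refine ⟨Metric.ball x (r / 2), Metric.isOpen_ball, Metric.mem_ball_self (by positivity), ?_⟩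
  have hsub : Metric.ball x (r / 2) ⊆ Ω :=
    (Metric.ball_subset_ball (by linarith)).trans hrΩ
  -- The mollifications have vanishing gradient on the ball, so they are constant there.
  have hFconst : ∀ k, ∀ y ∈ Metric.ball x (r / 2), F k y = F k x := by
    intro k y hy
    refine Metric.isOpen_ball.is_const_of_fderiv_eq_zero (𝕜 := ℝ)
      (convex_ball x (r / 2)).isPreconnected ((hF k).differentiable (by simp)).differentiableOn
      (fun w hw => ?_) hy (Metric.mem_ball_self (by positivity))
    obtain ⟨φ, hφ, hFφ⟩ := hFgrad k w (fun v hv => hrΩ (by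
      rw [Metric.mem_ball] at hw ⊢
      rw [Metric.mem_closedBall] at hv
      linarith [dist_triangle v w x]))
    rw [h φ hφ, neg_zero] at hFφ
    apply ContinuousLinearMap.coe_injective
    refine (EuclideanSpace.basisFun (Fin m) ℝ).toBasis.ext fun j => ?_
    simpa [partials] using congrFun hFφ j
  have hlim : ∀ᵐ y ∂(volume.restrict (Metric.ball x (r / 2))),
      Tendsto (fun k => F k x) atTop (𝓝 (f y)) := by
    filter_upwards [ae_restrict_of_ae_restrict_of_subset hsub hFf,
      ae_restrict_mem measurableSet_ball] with y hy hyB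
    simpa only [hFconst _ y hyB] using hy
  have hne : (ae (volume.restrict (Metric.ball x (r / 2)))).NeBot := by
    rw [ae_neBot, Ne, Measure.restrict_eq_zero]
    exact (Metric.measure_ball_pos volume x (by positivity)).ne'
  obtain ⟨y₀, hy₀⟩ := hlim.exists
  exact ⟨f y₀, hlim.mono fun y hy => tendsto_nhds_unique hy hy₀⟩

end Consequences

/-! ### Rigidity of two disjoint indicator functions -/

section ThreeStates

variable {m n N : ℕ} {Ω : Set (EuclideanSpace ℝ (Fin m))}

lemma transpose_mulVec_dotProduct {B : Matrix (Fin N) (Fin m) ℝ} (y : Fin N → ℂ) (w : Fin m → ℂ) :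
    ((Bᵀ.map ((↑) : ℝ → ℂ)) *ᵥ y) ⬝ᵥ w = y ⬝ᵥ (B.map ((↑) : ℝ → ℂ) *ᵥ w) := by
  rw [Matrix.dotProduct_mulVec, ← Matrix.mulVec_transpose, Matrix.transpose_map]

/-- If the indicators `χ₁`, `χ₂` of disjoint sets satisfy `B₁ ∇χ₁ + B₂ ∇χ₂ = 0` weakly, with `B₁`,
`B₂` and `B₁ - B₂` injective, then both weak gradients vanish. -/
lemma weakGrad_eq_zero_of_symbol_relation (hΩ : IsOpen Ω)
    {χ₁ χ₂ : EuclideanSpace ℝ (Fin m) → ℂ} (hχ₁ : IsBddMeas Ω χ₁) (hχ₂ : IsBddMeas Ω χ₂)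
    (h₁ : ∀ x, χ₁ x * χ₁ x = χ₁ x) (h₂ : ∀ x, χ₂ x * χ₂ x = χ₂ x) (h₁₂ : ∀ x, χ₁ x * χ₂ x = 0)
    {B₁ B₂ : Matrix (Fin N) (Fin m) ℝ} (hB₁ : ∀ ξ, B₁ *ᵥ ξ = 0 → ξ = 0)
    (hB₂ : ∀ ξ, B₂ *ᵥ ξ = 0 → ξ = 0) (hB₁₂ : ∀ ξ, (B₁ - B₂) *ᵥ ξ = 0 → ξ = 0)
    (hrel : ∀ φ, IsTestFunction Ω φ → B₁.map ((↑) : ℝ → ℂ) *ᵥ weakGrad Ω χ₁ φ +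
      B₂.map ((↑) : ℝ → ℂ) *ᵥ weakGrad Ω χ₂ φ = 0)
    {φ : EuclideanSpace ℝ (Fin m) → ℂ} (hφ : IsTestFunction Ω φ) :
    weakGrad Ω χ₁ φ = 0 ∧ weakGrad Ω χ₂ φ = 0 := by
  -- The complex directions in which both functions have vanishing weak derivative.
  let T : Submodule ℂ (Fin m → ℂ) :=
    { carrier := {z | ∀ φ, IsTestFunction Ω φ →
        z ⬝ᵥ weakGrad Ω χ₁ φ = 0 ∧ z ⬝ᵥ weakGrad Ω χ₂ φ = 0}
      add_mem' := fun {z w} hz hw φ hφ => by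
        simp [add_dotProduct, (hz φ hφ).1, (hz φ hφ).2, (hw φ hφ).1, (hw φ hφ).2]
      zero_mem' := fun φ _ => by simp
      smul_mem' := fun c z hz φ hφ => by simp [(hz φ hφ).1, (hz φ hφ).2] }
  suffices hT : T = ⊤ by
    have key : ∀ z : Fin m → ℂ, z ⬝ᵥ weakGrad Ω χ₁ φ = 0 ∧ z ⬝ᵥ weakGrad Ω χ₂ φ = 0 := fun z =>
      (show z ∈ T from hT ▸ Submodule.mem_top) φ hφ
    constructor <;> funext j
    · simpa using (key (Pi.single j 1)).1
    · simpa using (key (Pi.single j 1)).2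
  by_contra hT
  have : Nontrivial ((Fin m → ℂ) ⧸ T) := Submodule.Quotient.nontrivial_iff.2 hT
  set P := (B₁ᵀ.map ((↑) : ℝ → ℂ)).mulVecLin with hP
  set Q := (B₂ᵀ.map ((↑) : ℝ → ℂ)).mulVecLin with hQ
  have hPQ : P - Q = ((B₁ - B₂)ᵀ.map ((↑) : ℝ → ℂ)).mulVecLin := by
    refine LinearMap.ext fun y => ?_
    have hmap : (B₁ - B₂)ᵀ.map ((↑) : ℝ → ℂ) = B₁ᵀ.map (↑) - B₂ᵀ.map (↑) := by
      ext i j; simp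
    rw [hmap, Matrix.mulVecLin_apply, Matrix.sub_mulVec, LinearMap.sub_apply, hP, hQ,
      Matrix.mulVecLin_apply, Matrix.mulVecLin_apply]
  have hπ : Function.Surjective T.mkQ := T.mkQ_surjective
  obtain ⟨μ, y, hμ0, hμ1, hQP, hPy⟩ := exists_pencil_eigenvector (T.mkQ ∘ₗ P) (T.mkQ ∘ₗ Q)
    (hπ.comp (surjective_mulVecLin_transpose_map_ofReal B₁ hB₁))
    (hπ.comp (surjective_mulVecLin_transpose_map_ofReal B₂ hB₂)) (by
      rw [← LinearMap.comp_sub, hPQ]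
      exact hπ.comp (surjective_mulVecLin_transpose_map_ofReal _ hB₁₂))
  have hmem : Q y - μ • P y ∈ T := by
    rw [← Submodule.Quotient.mk_eq_zero, Submodule.Quotient.mk_sub, Submodule.Quotient.mk_smul]
    exact sub_eq_zero.2 hQP
  have hlin : ∀ φ, IsTestFunction Ω φ →
      P y ⬝ᵥ weakGrad Ω χ₁ φ + μ * (P y ⬝ᵥ weakGrad Ω χ₂ φ) = 0 := by
    intro φ hφ
    have e1 := congrArg (fun w => y ⬝ᵥ w) (hrel φ hφ)
    simp only [dotProduct_add, dotProduct_zero, ← transpose_mulVec_dotProduct] at e1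
    have e2 := (hmem φ hφ).2
    rw [sub_dotProduct, smul_dotProduct, smul_eq_mul] at e2
    simp only [hP, hQ, Matrix.mulVecLin_apply] at e1 e2 ⊢
    linear_combination e1 - e2
  have hbdd : IsBddMeas Ω (fun x => χ₁ x + μ * χ₂ x) := hχ₁.add (hχ₂.const_mul μ)
  -- As `χ₁`, `χ₂` are orthogonal idempotents, squaring only replaces `μ` by `μ ^ 2`.
  have hsq : (fun x => (χ₁ x + μ * χ₂ x) * (χ₁ x + μ * χ₂ x)) =
      fun x => χ₁ x + μ ^ 2 * χ₂ x := by
    funext x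
    linear_combination h₁ x + μ ^ 2 * h₂ x + 2 * μ * h₁₂ x
  refine hPy ((Submodule.Quotient.mk_eq_zero T).2 fun φ hφ => ?_)
  have e1 := hlin φ hφ
  have e2 := hbdd.dotProduct_weakGrad_sq_eq_zero hΩ (z := P y) (fun ψ hψ => by
    rw [weakGrad_add_const_mul hχ₁ hχ₂ hψ, dotProduct_add, dotProduct_smul, smul_eq_mul]
    exact hlin ψ hψ) hφ
  rw [hsq, weakGrad_add_const_mul hχ₁ hχ₂ hφ, dotProduct_add, dotProduct_smul, smul_eq_mul] at e2
  have e3 : P y ⬝ᵥ weakGrad Ω χ₂ φ = 0 := by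
    have : (μ * (μ - 1)) * (P y ⬝ᵥ weakGrad Ω χ₂ φ) = 0 := by linear_combination e2 - e1
    exact (mul_eq_zero.1 this).resolve_left (mul_ne_zero hμ0 (sub_ne_zero.2 hμ1))
  exact ⟨by simpa [e3] using e1, e3⟩

/-! ### The equation in terms of the indicator functions -/

namespace FirstOrderOp

variable (A : FirstOrderOp m n N)

/-- The matrix of the linear map `ξ ↦ 𝔸(ξ) η`, for fixed `η`. -/
def symbolAt (η : EuclideanSpace ℝ (Fin n)) : Matrix (Fin N) (Fin m) ℝ :=
  Matrix.of fun i j => (A.coeff j *ᵥ η.ofLp) i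

lemma symbolAt_mulVec (η : EuclideanSpace ℝ (Fin n)) (ξ : Fin m → ℝ) :
    A.symbolAt η *ᵥ ξ = A.symbol (WithLp.toLp 2 ξ) *ᵥ η.ofLp := by
  funext i
  simp only [symbolAt, symbol, Matrix.mulVec, Matrix.sum_apply, dotProduct, Finset.sum_mul,
    Matrix.of_apply, Matrix.smul_apply, smul_eq_mul]
  rw [Finset.sum_comm]
  exact Finset.sum_congr rfl fun k _ => Finset.sum_congr rfl fun j _ => by ring

lemma symbolAt_sub (η ζ : EuclideanSpace ℝ (Fin n)) :
    A.symbolAt (η - ζ) = A.symbolAt η - A.symbolAt ζ := by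
  ext i j
  simp [symbolAt, Matrix.mulVec_sub]

variable {A} in
lemma eq_zero_of_symbolAt_mulVec_eq_zero {η : EuclideanSpace ℝ (Fin n)} (hη : η ∉ A.waveCone)
    (ξ : Fin m → ℝ) (hξ : A.symbolAt η *ᵥ ξ = 0) : ξ = 0 := by
  by_contra hne
  refine hη ⟨WithLp.toLp 2 ξ, fun h => hne ?_, by rw [← symbolAt_mulVec, hξ]⟩
  simpa using congrArg WithLp.ofLp h

end FirstOrderOp

lemma integral_partial_eq_zero {φ : EuclideanSpace ℝ (Fin m) → ℝ} (hφ : ContDiff ℝ ∞ φ)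
    (hc : HasCompactSupport φ) (hs : tsupport φ ⊆ Ω) (v : EuclideanSpace ℝ (Fin m)) :
    ∫ x in Ω, fderiv ℝ φ x v = 0 := by
  have hsub : Function.support (fun x => fderiv ℝ φ x v) ⊆ Ω := fun x hx =>
    hs (support_fderiv_subset ℝ fun h0 => hx (by simp [h0]))
  rw [setIntegral_eq_integral_of_forall_compl_eq_zero fun x hx =>
    Function.notMem_support.1 fun h => hx (hsub h)]
  have hint : Integrable (fun x => fderiv ℝ φ x v) :=
    ((hφ.continuous_fderiv (by simp)).clm_apply continuous_const).integrable_of_hasCompactSupport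
      (hc.fderiv_apply ℝ v)
  have := integral_mul_fderiv_eq_neg_fderiv_mul_of_integrable (μ := volume) (𝕜 := ℝ)
    (f := fun _ : EuclideanSpace ℝ (Fin m) => (1 : ℝ)) (g := φ) (v := v) (by simp)
    (by simpa using hint) (by simpa using hφ.continuous.integrable_of_hasCompactSupport hc)
    (fun x _ => differentiableAt_const _) (fun x _ => hφ.differentiable (by simp) x)
  simpa using this
variable {k : EuclideanSpace ℝ (Fin m) → ℝ}

lemma integrable_mul_partial (hk : AEStronglyMeasurable k (volume.restrict Ω))
    (hk1 : ∀ x, |k x| ≤ 1) {φ : EuclideanSpace ℝ (Fin m) → ℝ} (hφ : ContDiff ℝ ∞ φ)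
    (hc : HasCompactSupport φ) (v : EuclideanSpace ℝ (Fin m)) :
    Integrable (fun x => k x * fderiv ℝ φ x v) (volume.restrict Ω) :=
  (((hφ.continuous_fderiv (by simp)).clm_apply continuous_const).integrable_of_hasCompactSupport
    (hc.fderiv_apply ℝ v)).integrableOn.bdd_mul (c := 1) hk (Filter.Eventually.of_forall hk1)

/-- The image of a complex test function under a real linear functional is a real test function.
This is applied to the real and imaginary parts. -/
lemma IsTestFunction.clm_comp {φ : EuclideanSpace ℝ (Fin m) → ℂ} (hφ : IsTestFunction Ω φ)
    (L : ℂ →L[ℝ] ℝ) : ContDiff ℝ ∞ (fun x => L (φ x)) ∧ HasCompactSupport (fun x => L (φ x)) ∧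
      tsupport (fun x => L (φ x)) ⊆ Ω :=
  ⟨L.contDiff.comp hφ.contDiff, hφ.hasCompactSupport.comp_left (g := L) (map_zero L),
    (tsupport_comp_subset (map_zero L) φ).trans hφ.tsupport_subset⟩

lemma weakGrad_ofReal (hk : AEStronglyMeasurable k (volume.restrict Ω)) (hk1 : ∀ x, |k x| ≤ 1)
    {φ : EuclideanSpace ℝ (Fin m) → ℂ} (hφ : IsTestFunction Ω φ) (j : Fin m) :
    weakGrad Ω (fun x => (k x : ℂ)) φ j =
      ((∫ x in Ω, k x * fderiv ℝ (fun x => Complex.reCLM (φ x)) x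
        (EuclideanSpace.single j 1) : ℝ) : ℂ) +
      Complex.I * ((∫ x in Ω, k x * fderiv ℝ (fun x => Complex.imCLM (φ x)) x
        (EuclideanSpace.single j 1) : ℝ) : ℂ) := by
  obtain ⟨r1, r2, -⟩ := hφ.clm_comp Complex.reCLM
  obtain ⟨i1, i2, -⟩ := hφ.clm_comp Complex.imCLM
  rw [← integral_complex_ofReal, ← integral_complex_ofReal, ← integral_const_mul, ← integral_add
    (integrable_mul_partial hk hk1 r1 r2 _).ofReal
    ((integrable_mul_partial hk hk1 i1 i2 _).ofReal.const_mul _)]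
  refine integral_congr_ae (Filter.Eventually.of_forall fun x => ?_)
  have hd := (hφ.contDiff.differentiable (by simp) x).hasFDerivAt
  have hr : fderiv ℝ (fun x => Complex.reCLM (φ x)) x = _ :=
    (Complex.reCLM.hasFDerivAt.comp x hd).fderiv
  have hi : fderiv ℝ (fun x => Complex.imCLM (φ x)) x = _ :=
    (Complex.imCLM.hasFDerivAt.comp x hd).fderiv
  simp only [hr, hi, partials, ContinuousLinearMap.comp_apply]
  apply Complex.ext <;> simp

namespace FirstOrderOp

variable {A : FirstOrderOp m n N} {u : EuclideanSpace ℝ (Fin m) → EuclideanSpace ℝ (Fin n)}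
  {k₁ k₂ : EuclideanSpace ℝ (Fin m) → ℝ} {b α β : EuclideanSpace ℝ (Fin n)}

/-- The equation for `u = b + k₁ α + k₂ β` in terms of `k₁` and `k₂`: the constant `b` drops out. -/
lemma DistribEqZero.real_relation (hA : A.DistribEqZero Ω u)
    (hk₁ : AEStronglyMeasurable k₁ (volume.restrict Ω)) (hk₁' : ∀ x, |k₁ x| ≤ 1)
    (hk₂ : AEStronglyMeasurable k₂ (volume.restrict Ω)) (hk₂' : ∀ x, |k₂ x| ≤ 1)
    (hu : ∀ᵐ x ∂(volume.restrict Ω), u x = b + k₁ x • α + k₂ x • β)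
    {φ : EuclideanSpace ℝ (Fin m) → ℝ} (hφ : ContDiff ℝ ∞ φ)
    (hc : HasCompactSupport φ) (hs : tsupport φ ⊆ Ω) (i : Fin N) :
    ∑ j, A.symbolAt α i j * (∫ x in Ω, k₁ x * fderiv ℝ φ x (EuclideanSpace.single j 1)) +
      ∑ j, A.symbolAt β i j * (∫ x in Ω, k₂ x * fderiv ℝ φ x (EuclideanSpace.single j 1)) =
      0 := by
  have h := hA φ hφ hc hs i
  rw [neg_eq_zero] at h
  have hI₁ := fun j => (integrable_mul_partial hk₁ hk₁' hφ hc
    (EuclideanSpace.single j (1 : ℝ))).const_mul (A.symbolAt α i j)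
  have hI₂ := fun j => (integrable_mul_partial hk₂ hk₂' hφ hc
    (EuclideanSpace.single j (1 : ℝ))).const_mul (A.symbolAt β i j)
  have hI₀ := fun j => (integrable_mul_partial (Ω := Ω) (k := fun _ => 1)
    aestronglyMeasurable_const (by simp) hφ hc
    (EuclideanSpace.single j (1 : ℝ))).const_mul (A.symbolAt b i j)
  rw [← h, ← Finset.sum_add_distrib, integral_congr_ae (g := fun x => ∑ j,
    ((A.symbolAt b i j * (1 * fderiv ℝ φ x (EuclideanSpace.single j 1)) +
      A.symbolAt α i j * (k₁ x * fderiv ℝ φ x (EuclideanSpace.single j 1))) +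
      A.symbolAt β i j * (k₂ x * fderiv ℝ φ x (EuclideanSpace.single j 1))))]
  · refine Eq.trans ?_
      (integral_finsetSum _ fun j _ => ((hI₀ j).add (hI₁ j)).add (hI₂ j)).symm
    refine Finset.sum_congr rfl fun j _ => ?_
    rw [integral_add' ((hI₀ j).add (hI₁ j)) (hI₂ j), integral_add' (hI₀ j) (hI₁ j)]
    simp [integral_const_mul, integral_partial_eq_zero hφ hc hs]
  · filter_upwards [hu] with x hx
    refine Finset.sum_congr rfl fun j _ => ?_
    rw [hx]
    simp only [symbolAt, Matrix.of_apply, WithLp.ofLp_add, WithLp.ofLp_smul, Matrix.mulVec_add,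
      Matrix.mulVec_smul, Pi.add_apply, Pi.smul_apply, smul_eq_mul]
    ring

lemma DistribEqZero.weakGrad_relation (hA : A.DistribEqZero Ω u)
    (hk₁ : AEStronglyMeasurable k₁ (volume.restrict Ω)) (hk₁' : ∀ x, |k₁ x| ≤ 1)
    (hk₂ : AEStronglyMeasurable k₂ (volume.restrict Ω)) (hk₂' : ∀ x, |k₂ x| ≤ 1)
    (hu : ∀ᵐ x ∂(volume.restrict Ω), u x = b + k₁ x • α + k₂ x • β)
    {φ : EuclideanSpace ℝ (Fin m) → ℂ} (hφ : IsTestFunction Ω φ) :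
    (A.symbolAt α).map ((↑) : ℝ → ℂ) *ᵥ weakGrad Ω (fun x => (k₁ x : ℂ)) φ +
      (A.symbolAt β).map ((↑) : ℝ → ℂ) *ᵥ weakGrad Ω (fun x => (k₂ x : ℂ)) φ = 0 := by
  funext i
  obtain ⟨r1, r2, r3⟩ := hφ.clm_comp Complex.reCLM
  obtain ⟨i1, i2, i3⟩ := hφ.clm_comp Complex.imCLM
  have hr := congrArg ((↑) : ℝ → ℂ) (hA.real_relation hk₁ hk₁' hk₂ hk₂' hu r1 r2 r3 i)
  have hi := congrArg ((↑) : ℝ → ℂ) (hA.real_relation hk₁ hk₁' hk₂ hk₂' hu i1 i2 i3 i)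
  simp only [Matrix.mulVec, dotProduct, Pi.add_apply, Matrix.map_apply,
    weakGrad_ofReal hk₁ hk₁' hφ, weakGrad_ofReal hk₂ hk₂' hφ, Pi.zero_apply, mul_add,
    Finset.sum_add_distrib, mul_left_comm _ Complex.I, ← Finset.mul_sum]
  simp only [Complex.ofReal_add, Complex.ofReal_sum, Complex.ofReal_mul,
    Complex.ofReal_zero] at hr hi
  linear_combination hr + Complex.I * hi

end FirstOrderOp

end ThreeStates

/-! ### The three-state problem -/

open FirstOrderOp in
theorem propositionA1 {m n N : ℕ} (A : FirstOrderOp m n N)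
    (Ω : Set (EuclideanSpace ℝ (Fin m))) (hΩ : IsOpen Ω) (hΩc : IsPreconnected Ω)
    (a : Fin 3 → EuclideanSpace ℝ (Fin n))
    (u : EuclideanSpace ℝ (Fin m) → EuclideanSpace ℝ (Fin n))
    (hu : A.IsStateSolution Ω a u) :
    ∃ c : EuclideanSpace ℝ (Fin n), ∀ᵐ x ∂(volume.restrict Ω), u x = c := by
  have hum : AEMeasurable u (volume.restrict Ω) := hu.memLp.aestronglyMeasurable.aemeasurable
  have hwave := hu.sub_notMem
  let k₁ : EuclideanSpace ℝ (Fin m) → ℝ := fun x => ({a 0} : Set _).indicator 1 (u x)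
  -- Removing `a 0` keeps the two indicators disjoint even if `a 0 = a 1`, which `m = 0` allows.
  let k₂ : EuclideanSpace ℝ (Fin m) → ℝ := fun x => ({a 1} \ {a 0} : Set _).indicator 1 (u x)
  have hk₁ : AEStronglyMeasurable k₁ (volume.restrict Ω) :=
    ((measurable_one.indicator (measurableSet_singleton _)).comp_aemeasurable
      hum).aestronglyMeasurable
  have hk₂ : AEStronglyMeasurable k₂ (volume.restrict Ω) :=
    ((measurable_one.indicator ((measurableSet_singleton _).diff
      (measurableSet_singleton _))).comp_aemeasurable hum).aestronglyMeasurable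
  have hk₁v : ∀ x, k₁ x = 0 ∨ k₁ x = 1 := fun x => by
    simp only [k₁, Set.indicator]; split_ifs <;> simp
  have hk₂v : ∀ x, k₂ x = 0 ∨ k₂ x = 1 := fun x => by
    simp only [k₂, Set.indicator]; split_ifs <;> simp
  have hk₁' : ∀ x, |k₁ x| ≤ 1 := fun x => by rcases hk₁v x with h | h <;> simp [h]
  have hk₂' : ∀ x, |k₂ x| ≤ 1 := fun x => by rcases hk₂v x with h | h <;> simp [h]
  have hk₁₂ : ∀ x, k₁ x * k₂ x = 0 := fun x => by
    by_cases h : u x = a 0 <;> simp [k₁, k₂, h]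
  have hdec : ∀ᵐ x ∂(volume.restrict Ω),
      u x = a 2 + k₁ x • (a 0 - a 2) + k₂ x • (a 1 - a 2) := by
    filter_upwards [hu.mem_states] with x ⟨s, hs⟩
    by_cases h0 : u x = a 0
    · simp [k₁, k₂, h0]
    by_cases h1 : u x = a 1
    · have : a 1 ≠ a 0 := h1 ▸ h0
      simp [k₁, k₂, h1, this]
    have h2 : u x = a 2 := by
      fin_cases s
      · exact absurd hs.symm h0
      · exact absurd hs.symm h1
      · exact hs.symm
    simp [k₁, k₂, h0, h1, ← h2]
  have hχ₁ : IsBddMeas Ω (fun x => (k₁ x : ℂ)) :=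
    ⟨Complex.continuous_ofReal.comp_aestronglyMeasurable hk₁, 1, fun x => by
      simpa using hk₁' x⟩
  have hχ₂ : IsBddMeas Ω (fun x => (k₂ x : ℂ)) :=
    ⟨Complex.continuous_ofReal.comp_aestronglyMeasurable hk₂, 1, fun x => by
      simpa using hk₂' x⟩
  have hgrad := fun φ (hφ : IsTestFunction Ω φ) =>
    weakGrad_eq_zero_of_symbol_relation hΩ hχ₁ hχ₂
      (fun x => by rcases hk₁v x with h | h <;> simp [h])
      (fun x => by rcases hk₂v x with h | h <;> simp [h])
      (fun x => by exact_mod_cast hk₁₂ x)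
      (eq_zero_of_symbolAt_mulVec_eq_zero (hwave 0 2 (by decide)))
      (eq_zero_of_symbolAt_mulVec_eq_zero (hwave 1 2 (by decide)))
      (by
        rw [← symbolAt_sub, sub_sub_sub_cancel_right]
        exact eq_zero_of_symbolAt_mulVec_eq_zero (hwave 0 1 (by decide)))
      (fun φ hφ => hu.distribEqZero.weakGrad_relation hk₁ hk₁' hk₂ hk₂' hdec hφ) hφ
  obtain ⟨c₁, hc₁⟩ := hχ₁.ae_eq_const hΩ hΩc fun φ hφ => (hgrad φ hφ).1
  obtain ⟨c₂, hc₂⟩ := hχ₂.ae_eq_const hΩ hΩc fun φ hφ => (hgrad φ hφ).2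
  refine ⟨a 2 + c₁.re • (a 0 - a 2) + c₂.re • (a 1 - a 2), ?_⟩
  filter_upwards [hdec, hc₁, hc₂] with x hx h1 h2
  rw [hx, ← h1, ← h2, Complex.ofReal_re, Complex.ofReal_re]
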